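/- Let $n,d\ge 1$ and $f(x)=\frac1n\sum_{i=1}^n f_i(x)$ on $\mathbb R^d$, where each $f_i:\mathbb R^d\to\mathbb R$ is differentiable, is bounded below by $\bar f_i\in\mathbb R$, and has an $L$-Lipschitz gradient for a common $L>0$. Let $\bar f\in\mathbb R$ be a lower bound of $f$. Random reshuffling (RR) with step size $\alpha$ starts at $x_0\in\mathbb R^d$; in iteration $t=0,1,\dots$ it draws a permutation $\pi_t$ of $\{1,\dots,n\}$ uniformly at random, independently of the previous ones, sets $x_t^0=x_t$, $x_t^i=x_t^{i-1}-\alpha\nabla f_{\pi_t^i}(x_t^{i-1})$ for $i=1,\dots,n$, and $x_{t+1}=x_t^n$. Thus $T$ iterations use $nT$ evaluations of component gradients. For $T\ge 1$ and $\delta\in(0,1)$ put $$A=2L,\quad B=\frac An\sum_{i=1}^n(\bar f-\bar f_i),\quad F=3(f(x_0)-\bar f)+\frac{3B}{A},\quad C_1=32L^2A\log^2\frac{8nT}{\delta},$$ and let RR use the constant step size $\alpha=\min\bigl\{\frac1{4nL},\,(C_1n^2T)^{-1/3}\bigr\}$. (i) With probability at least $1-\delta$, $$\frac1T\sum_{t=0}^{T-1}\|\nabla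 f(x_t)\|^2\le\max\left\{\frac{45LF}{T},\ \frac{35\,L^{2/3}A^{1/3}F\log^{2/3}(8nT/\delta)}{n^{1/3}T^{2/3}}\right\}.$$ (ii) Consequently, RR needs at most $nT=\tilde{\mathcal O}(\max\{\sqrt n\,\varepsilon^{-3},n\varepsilon^{-2}\})$ gradient evaluations to make this average at most $\varepsilon^2$. Precisely: for all $L>0$ and $\Phi\in\mathbb R$ there is a constant $K>0$, depending only on $L$ and $\Phi$, such that for all $n\ge1$, $\varepsilon\in(0,1]$ and $\delta\in(0,1)$ there is an integer $T_0\ge1$ with $$nT_0\le K\max\{\sqrt n\,\varepsilon^{-3},\,n\varepsilon^{-2}\}\bigl(1+\log(\sqrt n\,\varepsilon^{-3}/\delta)\bigr)$$ such that for every $T\ge T_0$, and for every problem as above with $F\le\Phi$, RR with the above step size satisfies $\frac1T\sum_{t=0}^{T-1}\|\nabla f(x_t)\|^2\le\varepsilon^2$ with probability at least $1-\delta$. -/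

import Mathlib

open MeasureTheory ProbabilityTheory
open scoped NNReal

noncomputable section

namespace RandomReshuffling

/-- The finite-sum objective `f(x) = (1/n) ∑ i, f_i(x)` on `ℝ^d`. -/
def objective {d n : ℕ} (f : Fin n → EuclideanSpace ℝ (Fin d) → ℝ)
    (x : EuclideanSpace ℝ (Fin d)) : ℝ :=
  (1 / (n : ℝ)) * ∑ i, f i x

/-- Every component `f_i` is differentiable, is bounded from below by `lb i`, and has an
`L`-Lipschitz gradient. -/
structure SmoothBoundedBelow {d n : ℕ} (f : Fin n → EuclideanSpace ℝ (Fin d) → ℝ)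
    (lb : Fin n → ℝ) (L : ℝ≥0) : Prop where
  differentiable : ∀ i, Differentiable ℝ (f i)
  lower_bound : ∀ i x, lb i ≤ f i x
  lipschitz : ∀ i, LipschitzWith L (gradient (f i))

/-- `π 0, π 1, …` are independent random permutations of the `n` indices, each of them uniformly
distributed on all permutations. -/
structure IsUniformReshuffling {Ω : Type*} [MeasurableSpace Ω] (μ : Measure Ω) {n : ℕ}
    (π : ℕ → Ω → Equiv.Perm (Fin n)) : Prop where
  measurable : ∀ t σ, MeasurableSet {ω | π t ω = σ}
  uniform : ∀ t σ, μ.real {ω | π t ω = σ} = 1 / (Nat.factorial n : ℝ)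
  indep : iIndepFun (m := fun _ => (⊤ : MeasurableSpace (Equiv.Perm (Fin n)))) π μ

/-- The inner iterates of one pass: `innerIterate f α σ x i` is the point reached from `x` after
the first `i` gradient steps, taken along the components `σ 0, σ 1, …` in this order. Only
`i ≤ n` is meaningful; the value stays constant afterwards. -/
def innerIterate {d n : ℕ} (f : Fin n → EuclideanSpace ℝ (Fin d) → ℝ) (α : ℝ)
    (σ : Equiv.Perm (Fin n)) (x : EuclideanSpace ℝ (Fin d)) : ℕ → EuclideanSpace ℝ (Fin d)
  | 0 => x
  | i + 1 =>
    if h : i < n then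
      innerIterate f α σ x i - α • gradient (f (σ ⟨i, h⟩)) (innerIterate f α σ x i)
    else innerIterate f α σ x i

/-- The outer iterates `x_t` of random reshuffling, started at `x₀`, with step sizes `α t` and
with the permutation `σ t` used in pass `t`. Each pass evaluates `n` component gradients. -/
def iterate {d n : ℕ} (f : Fin n → EuclideanSpace ℝ (Fin d) → ℝ) (α : ℕ → ℝ)
    (σ : ℕ → Equiv.Perm (Fin n)) (x₀ : EuclideanSpace ℝ (Fin d)) :
    ℕ → EuclideanSpace ℝ (Fin d)
  | 0 => x₀
  | t + 1 => innerIterate f (α t) (σ t) (iterate f α σ x₀ t) n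

/-- The constant `A = 2L`. -/
def constA (L : ℝ) : ℝ := 2 * L

/-- The constant `B = (A/n) ∑ i, (f̄ - f̄_i)`, with `fbar = f̄` and `lb i = f̄_i`. -/
def constB (L : ℝ) {n : ℕ} (lb : Fin n → ℝ) (fbar : ℝ) : ℝ :=
  constA L / n * ∑ i, (fbar - lb i)

/-- The constant `F = 3 (f(x₀) - f̄) + 3 B / A`. -/
def constF (L : ℝ) {d n : ℕ} (f : Fin n → EuclideanSpace ℝ (Fin d) → ℝ) (lb : Fin n → ℝ)
    (fbar : ℝ) (x₀ : EuclideanSpace ℝ (Fin d)) : ℝ :=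
  3 * (objective f x₀ - fbar) + 3 * constB L lb fbar / constA L

/-- The constant `C₁ = 32 L² A log²(8nT/δ)`. -/
def constC₁ (L : ℝ) (n T : ℕ) (δ : ℝ) : ℝ :=
  32 * L ^ 2 * constA L * Real.log (8 * n * T / δ) ^ 2

/-- The constant step size `α = min {1/(4nL), 1/(C₁ n² T)^{1/3}}`. -/
def stepSize (L : ℝ) (n T : ℕ) (δ : ℝ) : ℝ :=
  min (1 / (4 * n * L)) (1 / (constC₁ L n T δ * (n : ℝ) ^ 2 * T) ^ (1 / 3 : ℝ))

/-- `(1/T) ∑_{t < T} ‖∇f(x_t)‖²` along the run of random reshuffling with the above constant step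
size for the horizon `T` and the confidence parameter `δ`. -/
def avgSqGrad (L : ℝ) {d n : ℕ} (f : Fin n → EuclideanSpace ℝ (Fin d) → ℝ)
    (x₀ : EuclideanSpace ℝ (Fin d)) (T : ℕ) (δ : ℝ) (σ : ℕ → Equiv.Perm (Fin n)) : ℝ :=
  (1 / (T : ℝ)) * ∑ t ∈ Finset.range T,
    ‖gradient (objective f) (iterate f (fun _ => stepSize L n T δ) σ x₀ t)‖ ^ 2

end RandomReshuffling

end

/-! Everything is measured by one Lyapunov function, `gap x = f x - (1/n) ∑ lb i`, because `fbar`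
cancels from `constF`, leaving `F = 3 * gap x₀`. By smoothness the total variance of the component
gradients at `x` is at most `2 L n * gap x`.

One pass is a full gradient step of length `n α` plus an error `e`, the change of the component
gradients along the pass. Its size is governed by the partial sums of the permuted gradient
deviations. If these are at most `2 l` times the root of the total variance (`IsBalanced`), then
`gap_innerIterate_le` gives `gap x⁺ + (n α / 3) ‖∇f x‖² ≤ (1 + q) gap x` with `q = 16 α³ n² L³ l²`.
The step size forces `T q ≤ 1`, so `(1 + q)^T ≤ 3`, and telescoping bounds the average by `3 F / (n
α T)`.

Balance is a dimension-free tail bound for sampling without replacement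
(`card_perm_norm_partial_sum_gt_le`), obtained from an exponential moment by induction on the number
of indices. As `x_t` depends only on earlier permutations, the bound applies conditionally in each
pass; a union over `n` prefixes and `T` passes, with `l = log (8 n T / δ)`, costs exactly `δ`.

The complexity claim then only requires solving the rate for `T`, where `T` also occurs inside the
logarithm. -/

noncomputable section

namespace RandomReshuffling

/-! ### Concentration of sampling without replacement in an inner product space -/

section Concentration

variable {E : Type*} [NormedAddCommGroup E]

/-- A smooth substitute for `exp ‖x‖`. -/
def expNorm (x : E) : ℝ := Real.exp (Real.sqrt (1 + ‖x‖ ^ 2))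

lemma exp_norm_le_expNorm (x : E) : Real.exp ‖x‖ ≤ expNorm x := by
  refine Real.exp_le_exp.2 (Real.le_sqrt_of_sq_le (by linarith))

lemma expNorm_pos (x : E) : 0 < expNorm x := Real.exp_pos _

lemma expNorm_zero : expNorm (0 : E) = Real.exp 1 := by simp [expNorm]

variable [InnerProductSpace ℝ E]

/-- The exponent grows by at most `a + b`, where `a` is the linear term and `b = ‖w‖² / 2`, since `r
≥ 1`; then `exp y ≤ 1 + y + y²` for `|y| ≤ 1`. The linear term is kept explicit because it vanishes
on averaging over a centred family. -/
lemma expNorm_add_le (u w : E) (hw : ‖w‖ ≤ 1 / 2) :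
    expNorm (u + w) ≤
      expNorm u * (1 + inner ℝ ((Real.sqrt (1 + ‖u‖ ^ 2))⁻¹ • u) w + 3 * ‖w‖ ^ 2) := by
  set r := Real.sqrt (1 + ‖u‖ ^ 2) with hr
  have hr2 : r ^ 2 = 1 + ‖u‖ ^ 2 := Real.sq_sqrt (by positivity)
  have hr1 : 1 ≤ r := Real.one_le_sqrt.2 (by nlinarith [sq_nonneg ‖u‖])
  have hr0 : 0 < r := by linarith
  have hur : ‖u‖ ≤ r := abs_le_of_sq_le_sq' (by linarith) hr0.le |>.2
  set a : ℝ := inner ℝ (r⁻¹ • u) w with ha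
  have ha' : a = inner ℝ u w / r := by
    rw [ha, real_inner_smul_left]; field_simp
  have hra : r * a = inner ℝ u w := by rw [ha']; field_simp
  have habs : |a| ≤ ‖w‖ := by
    refine (abs_real_inner_le_norm _ _).trans ?_
    have : ‖r⁻¹ • u‖ ≤ 1 := by
      rw [norm_smul, norm_inv, Real.norm_of_nonneg hr0.le, inv_mul_le_iff₀ hr0]; linarith
    nlinarith [norm_nonneg w]
  obtain ⟨ha1, ha2⟩ := abs_le.1 habs
  have hw0 := norm_nonneg w
  set b : ℝ := ‖w‖ ^ 2 / 2 with hb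
  have hsqrt : Real.sqrt (1 + ‖u + w‖ ^ 2) ≤ r + (a + b) := by
    refine Real.sqrt_le_iff.2 ⟨by nlinarith, ?_⟩
    rw [norm_add_sq_real, ← hra]
    nlinarith [sq_nonneg (a + b), sq_nonneg ‖w‖]
  have hy : |a + b| ≤ 1 := abs_le.2 ⟨by nlinarith, by nlinarith⟩
  have hexp : Real.exp (a + b) ≤ 1 + (a + b) + (a + b) ^ 2 := by
    have := abs_le.1 (Real.abs_exp_sub_one_sub_id_le hy)
    linarith [this.2]
  have hsq : (a + b) ^ 2 ≤ (25 / 16) * ‖w‖ ^ 2 := by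
    have h1 : |a + b| ≤ 5 / 4 * ‖w‖ := abs_le.2 ⟨by nlinarith, by nlinarith⟩
    have := sq_le_sq' (abs_le.1 h1).1 (abs_le.1 h1).2
    nlinarith
  calc expNorm (u + w) ≤ Real.exp (r + (a + b)) := Real.exp_le_exp.2 hsqrt
    _ = expNorm u * Real.exp (a + b) := by rw [Real.exp_add]; rfl
    _ ≤ _ := by
      refine mul_le_mul_of_nonneg_left ?_ (expNorm_pos u).le
      nlinarith [sq_nonneg ‖w‖]

/-- Extension of a finite family by zero to all natural indices. -/
def extendZero {n : ℕ} {M : Type*} [Zero M] (v : Fin n → M) (j : ℕ) : M :=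
  if h : j < n then v ⟨j, h⟩ else 0

lemma extendZero_zero {n : ℕ} {M : Type*} [Zero M] (v : Fin (n + 1) → M) :
    extendZero v 0 = v 0 := by simp [extendZero]

lemma extendZero_succ {n : ℕ} {M : Type*} [Zero M] (v : Fin (n + 1) → M) (j : ℕ) :
    extendZero v (j + 1) = extendZero (fun k : Fin n => v k.succ) j := by
  unfold extendZero
  by_cases h : j < n <;> simp [h]

lemma sum_extendZero_add_const {n : ℕ} (v : Fin n → E) (c : E) {i : ℕ} (hi : i ≤ n) :
    ∑ j ∈ Finset.range i, extendZero v j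
      = ∑ j ∈ Finset.range i, extendZero (fun k => v k + c) j - (i : ℝ) • c := by
  have : ∀ j ∈ Finset.range i, extendZero (fun k => v k + c) j = extendZero v j + c := by
    intro j hj
    have : j < n := (Finset.mem_range.1 hj).trans_le hi
    simp [extendZero, this]
  rw [Finset.sum_congr rfl this, Finset.sum_add_distrib]
  simp [Nat.cast_smul_eq_nsmul]

/-- Effect of one uniform draw: centring kills the linear term, and the bound on the sum of squares
makes every vector short enough for the local expansion. -/
lemma sum_expNorm_add_smul_le {n : ℕ} (v : Fin n → E) (hv : ∑ k, v k = 0)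
    (hQ : ∑ k, ‖v k‖ ^ 2 ≤ 1 / 4) (u : E) {c : ℝ} (hc0 : 0 ≤ c) (hc1 : c ≤ 1) :
    ∑ p, expNorm (u + c • v p) ≤ expNorm u * (n + 3 * c ^ 2 * ∑ k, ‖v k‖ ^ 2) := by
  have hstep : ∀ p, expNorm (u + c • v p) ≤ expNorm u *
      (1 + inner ℝ ((Real.sqrt (1 + ‖u‖ ^ 2))⁻¹ • u) (c • v p) + 3 * (c ^ 2 * ‖v p‖ ^ 2)) := by
    intro p
    have h1 : ‖v p‖ ^ 2 ≤ 1 / 4 :=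
      (Finset.single_le_sum (f := fun k => ‖v k‖ ^ 2) (fun _ _ => by positivity)
        (Finset.mem_univ p)).trans hQ
    have h2 : ‖v p‖ ≤ 1 / 2 := by nlinarith [norm_nonneg (v p)]
    have h3 : ‖c • v p‖ = c * ‖v p‖ := by rw [norm_smul, Real.norm_of_nonneg hc0]
    have := expNorm_add_le u (c • v p) (by rw [h3]; nlinarith [norm_nonneg (v p)])
    rwa [h3, mul_pow] at this
  refine (Finset.sum_le_sum fun p _ => hstep p).trans (le_of_eq ?_)
  rw [← Finset.mul_sum, Finset.sum_add_distrib, Finset.sum_add_distrib, ← inner_sum,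
    ← Finset.smul_sum, hv, ← Finset.mul_sum, ← Finset.mul_sum]
  simp
  ring_nf
  simp

/-- The map `k ↦ swap 0 p k.succ` enumerates the indices other than `p`, in the form used by
`Equiv.Perm.decomposeFin`. -/
lemma sum_swap_succ {n : ℕ} {M : Type*} [AddCommGroup M] (v : Fin (n + 1) → M)
    (p : Fin (n + 1)) :
    ∑ k : Fin n, v (Equiv.swap 0 p k.succ) = ∑ k, v k - v p := by
  have h := Equiv.sum_comp (Equiv.swap 0 p) v
  rw [Fin.sum_univ_succ, Equiv.swap_apply_left] at h
  rw [← h]; abel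

/-- Exponential moment of the partial sums of a randomly permuted centred family. -/
theorem sum_perm_expNorm_le {n : ℕ} : ∀ (v : Fin n → E), ∑ k, v k = 0 →
    ∑ k, ‖v k‖ ^ 2 ≤ 1 / 4 → ∀ (u : E) (i : ℕ), i ≤ n →
    ∑ σ : Equiv.Perm (Fin n), expNorm (u + ∑ j ∈ Finset.range i, extendZero (fun k => v (σ k)) j)
      ≤ n.factorial * (expNorm u * Real.exp (3 * (∑ k, ‖v k‖ ^ 2) * (i / n))) := by
  induction n with
  | zero =>
    intro v _ _ u i hi
    obtain rfl : i = 0 := by omega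
    simp
  | succ n ih =>
    intro v hv hQ u i hi
    rcases i with _ | i
    · simp [Fintype.card_perm]
    have hin : i ≤ n := by omega
    set Q := ∑ k, ‖v k‖ ^ 2 with hQdef
    have hQ0 : 0 ≤ Q := Finset.sum_nonneg fun _ _ => by positivity
    -- Condition on the first draw `p`. Recentring the remaining `n` vectors adds `v p / n` to each,
    -- so `i` of them absorb `i / n` of `v p`. For `n = 0` the quotient is read as `0`, giving `c =
    -- 1`.
    set c : ℝ := 1 - i / n with hc
    have hin' : (i : ℝ) / n ≤ 1 := div_le_one_of_le₀ (by exact_mod_cast hin) (by positivity)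
    have hc1 : c ≤ 1 := by have : (0 : ℝ) ≤ i / n := by positivity
                           linarith
    have hc0 : 0 ≤ c := by linarith
    have inner_bound : ∀ p : Fin (n + 1), ∑ e : Equiv.Perm (Fin n),
        expNorm (u + ∑ j ∈ Finset.range (i + 1),
          extendZero (fun k => v (Equiv.Perm.decomposeFin.symm (p, e) k)) j)
        ≤ n.factorial * (expNorm (u + c • v p) * Real.exp (3 * Q * (i / n))) := by
      intro p
      set w : Fin n → E := fun k => v (Equiv.swap 0 p k.succ) + (n : ℝ)⁻¹ • v p with hw
      have hsumw : ∑ k, w k = 0 := by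
        rcases Nat.eq_zero_or_pos n with rfl | hn
        · simp
        have hn' : (n : ℝ) ≠ 0 := by positivity
        rw [hw, Finset.sum_add_distrib, sum_swap_succ, hv, Finset.sum_const, Finset.card_univ,
          Fintype.card_fin, ← Nat.cast_smul_eq_nsmul ℝ, smul_smul, mul_inv_cancel₀ hn']
        simp
      -- Recentring does not increase the sum of squares: the cross terms give `-2 ‖v p‖² / n`,
      -- outweighing the added `‖v p‖² / n`.
      have hQw : ∑ k, ‖w k‖ ^ 2 ≤ Q := by
        have hexp : ∀ k, ‖w k‖ ^ 2 = ‖v (Equiv.swap 0 p k.succ)‖ ^ 2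
            + 2 * (n : ℝ)⁻¹ * inner ℝ (v (Equiv.swap 0 p k.succ)) (v p)
            + (n : ℝ)⁻¹ ^ 2 * ‖v p‖ ^ 2 := by
          intro k
          rw [hw, norm_add_sq_real, norm_smul, real_inner_smul_right, mul_pow, norm_inv,
            Real.norm_natCast]
          ring
        rw [Finset.sum_congr rfl fun k _ => hexp k, Finset.sum_add_distrib,
          Finset.sum_add_distrib, ← Finset.mul_sum, ← sum_inner, sum_swap_succ, hv,
          sum_swap_succ (fun k => ‖v k‖ ^ 2), Finset.sum_const, Finset.card_univ,
          Fintype.card_fin, nsmul_eq_mul, zero_sub, inner_neg_left, real_inner_self_eq_norm_sq]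
        have h1 : (n : ℝ) * ((n : ℝ)⁻¹ ^ 2 * ‖v p‖ ^ 2) = (n : ℝ)⁻¹ * ‖v p‖ ^ 2 := by
          rcases Nat.eq_zero_or_pos n with rfl | hn
          · simp
          field_simp
        have h2 : 0 ≤ (n : ℝ)⁻¹ * ‖v p‖ ^ 2 := by positivity
        nlinarith [sq_nonneg ‖v p‖]
      have hpart : ∀ e : Equiv.Perm (Fin n), u + ∑ j ∈ Finset.range (i + 1),
          extendZero (fun k => v (Equiv.Perm.decomposeFin.symm (p, e) k)) j
          = (u + c • v p) + ∑ j ∈ Finset.range i, extendZero (fun k => w (e k)) j := by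
        intro e
        rw [Finset.sum_range_succ', extendZero_zero]
        simp only [extendZero_succ, Equiv.Perm.decomposeFin_symm_apply_succ,
          Equiv.Perm.decomposeFin_symm_apply_zero]
        rw [sum_extendZero_add_const _ ((n : ℝ)⁻¹ • v p) hin, smul_smul, hc, sub_smul, one_smul,
          div_eq_mul_inv]
        abel
      simp only [hpart]
      refine (ih w hsumw (hQw.trans hQ) _ i hin).trans ?_
      gcongr
      exact (expNorm_pos _).le
    rw [← Equiv.sum_comp Equiv.Perm.decomposeFin.symm, Fintype.sum_prod_type]
    refine (Finset.sum_le_sum fun p _ => inner_bound p).trans ?_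
    rw [← Finset.mul_sum, ← Finset.sum_mul]
    have hmain := sum_expNorm_add_smul_le v hv hQ u hc0 hc1
    have hn1 : (0 : ℝ) < (n + 1 : ℕ) := by positivity
    -- This closes the induction on the exponent; the slack is exactly `(c - c²) / (n + 1)`,
    -- nonnegative for `c ∈ [0, 1]`.
    have hcoef : c ^ 2 / (n + 1 : ℕ) + (i : ℝ) / n ≤ ((i + 1 : ℕ) : ℝ) / (n + 1 : ℕ) := by
      have hcn : c * n = n - i := by
        rcases Nat.eq_zero_or_pos n with rfl | hn
        · simp; omega
        rw [hc]; field_simp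
      have hci : (i : ℝ) / n = 1 - c := by rw [hc]; ring
      rw [hci, ← sub_nonneg]
      have : ((i + 1 : ℕ) : ℝ) / (n + 1 : ℕ) - (c ^ 2 / (n + 1 : ℕ) + (1 - c))
          = (c - c ^ 2) / (n + 1 : ℕ) := by
        field_simp
        push_cast
        linarith
      rw [this]
      exact div_nonneg (by nlinarith) hn1.le
    have hfin : ∑ p, expNorm (u + c • v p) * 1 ≤
        (n + 1 : ℕ) * (expNorm u * Real.exp (3 * Q * (c ^ 2 / (n + 1 : ℕ)))) := by
      simp only [mul_one]
      refine hmain.trans ?_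
      have h := Real.add_one_le_exp (3 * Q * (c ^ 2 / (n + 1 : ℕ)))
      calc expNorm u * ((n + 1 : ℕ) + 3 * c ^ 2 * Q)
          = (n + 1 : ℕ) * (expNorm u * (3 * Q * (c ^ 2 / (n + 1 : ℕ)) + 1)) := by
            field_simp; ring
        _ ≤ _ := by
          have := (expNorm_pos u).le
          gcongr
    simp only [mul_one] at hfin
    calc (n.factorial : ℝ) * ((∑ p, expNorm (u + c • v p)) * Real.exp (3 * Q * (i / n)))
        ≤ n.factorial * (((n + 1 : ℕ) * (expNorm u * Real.exp (3 * Q * (c ^ 2 / (n + 1 : ℕ)))))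
            * Real.exp (3 * Q * (i / n))) := by gcongr
      _ = (n + 1).factorial *
            (expNorm u * Real.exp (3 * Q * (c ^ 2 / (n + 1 : ℕ) + i / n))) := by
          rw [mul_add, Real.exp_add, Nat.factorial_succ]; push_cast; ring
      _ ≤ _ := by
          have := (expNorm_pos u).le
          gcongr

/-- Without-replacement tail bound, free of the dimension. -/
theorem card_perm_norm_partial_sum_gt_le {n : ℕ} (v : Fin n → E) (hv : ∑ k, v k = 0) {i : ℕ}
    (hi : i ≤ n) (l : ℝ) :
    ((Finset.univ.filter fun σ : Equiv.Perm (Fin n) =>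
      2 * l * Real.sqrt (∑ k, ‖v k‖ ^ 2)
        < ‖∑ j ∈ Finset.range i, extendZero (fun k => v (σ k)) j‖).card : ℝ)
      ≤ n.factorial * (8 * Real.exp (-l)) := by
  set Q := ∑ k, ‖v k‖ ^ 2 with hQdef
  have hQ0 : 0 ≤ Q := Finset.sum_nonneg fun _ _ => by positivity
  rcases hQ0.eq_or_lt with hQ | hQ
  · have hv0 : ∀ k, v k = 0 := by
      intro k
      have := (Finset.sum_eq_zero_iff_of_nonneg (fun k _ => by positivity)).1 hQ.symm k
        (Finset.mem_univ k)
      simpa using this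
    have : ∀ (σ : Equiv.Perm (Fin n)) (j : ℕ), extendZero (fun k => v (σ k)) j = 0 := by
      intro σ j; simp [extendZero, hv0]
    simp only [this, ← hQ]
    simp
    positivity
  have hs : 0 < Real.sqrt Q := Real.sqrt_pos.2 hQ
  -- Rescale to total square `1 / 4`, the largest value the moment bound allows, then apply Markov's
  -- inequality. The prefactor is at most `exp (1 + 3 / 4) ≤ 8`.
  set r : ℝ := (2 * Real.sqrt Q)⁻¹ with hr
  have hr0 : 0 < r := by positivity
  have hrQ : r ^ 2 * Q = 1 / 4 := by
    rw [hr, inv_pow, mul_pow, Real.sq_sqrt hQ0]; field_simp; norm_num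
  have hsum : ∑ k, ‖r • v k‖ ^ 2 = 1 / 4 := by
    simp only [norm_smul, mul_pow, ← Finset.mul_sum, Real.norm_of_nonneg hr0.le]
    exact hrQ
  have hmom := sum_perm_expNorm_le (fun k => r • v k) (by rw [← Finset.smul_sum, hv, smul_zero])
    hsum.le 0 i hi
  rw [hsum, expNorm_zero] at hmom
  have hscale : ∀ σ : Equiv.Perm (Fin n),
      (0 : E) + ∑ j ∈ Finset.range i, extendZero (fun k => r • v (σ k)) j
        = r • ∑ j ∈ Finset.range i, extendZero (fun k => v (σ k)) j := by
    intro σ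
    rw [zero_add, Finset.smul_sum]
    refine Finset.sum_congr rfl fun j _ => ?_
    unfold extendZero
    split_ifs <;> simp
  simp only [hscale] at hmom
  set bad := Finset.univ.filter fun σ : Equiv.Perm (Fin n) => 2 * l * Real.sqrt Q
        < ‖∑ j ∈ Finset.range i, extendZero (fun k => v (σ k)) j‖ with hbad
  have hlow : (bad.card : ℝ) * Real.exp l ≤ ∑ σ : Equiv.Perm (Fin n),
      expNorm (r • ∑ j ∈ Finset.range i, extendZero (fun k => v (σ k)) j) := by
    rw [← nsmul_eq_mul]
    refine (Finset.card_nsmul_le_sum bad _ _ fun σ hσ => ?_).trans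
      (Finset.sum_le_univ_sum_of_nonneg fun σ => (expNorm_pos _).le)
    refine le_trans (Real.exp_le_exp.2 ?_) (exp_norm_le_expNorm _)
    have := (Finset.mem_filter.1 hσ).2
    rw [norm_smul, Real.norm_of_nonneg hr0.le, hr, ← div_eq_inv_mul, le_div_iff₀ (by positivity)]
    linarith
  have hin : (i : ℝ) / n ≤ 1 := div_le_one_of_le₀ (by exact_mod_cast hi) (by positivity)
  have hconst : Real.exp 1 * Real.exp (3 * (1 / 4) * (i / n)) ≤ 8 := by
    rw [← Real.exp_add]
    have h1 : Real.exp (1 + 3 * (1 / 4) * (i / n)) ≤ Real.exp 2 := Real.exp_le_exp.2 (by linarith)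
    have h2 : Real.exp 2 = Real.exp 1 ^ 2 := by rw [← Real.exp_nat_mul]; norm_num
    have h3 := Real.exp_one_lt_d9
    have h4 := Real.exp_pos 1
    nlinarith
  have hfin := hlow.trans (hmom.trans (mul_le_mul_of_nonneg_left hconst (by positivity)))
  rw [Real.exp_neg, ← mul_assoc, ← div_eq_mul_inv, le_div_iff₀ (Real.exp_pos l)]
  exact hfin

end Concentration

/-! ### Consequences of a Lipschitz gradient -/

section Smooth

variable {E : Type*} [NormedAddCommGroup E] [InnerProductSpace ℝ E] [CompleteSpace E]

/-- The descent lemma for functions with Lipschitz gradient. -/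
theorem le_add_inner_gradient_add_sq {f : E → ℝ} {L : ℝ≥0} (hf : Differentiable ℝ f)
    (hL : LipschitzWith L (gradient f)) (x w : E) :
    f (x + w) ≤ f x + inner ℝ (gradient f x) w + L / 2 * ‖w‖ ^ 2 := by
  -- The defect of the quadratic upper bound along the segment is antitone in `s`; comparing `s = 0`
  -- with `s = 1` gives the claim.
  set h : ℝ → ℝ := fun s =>
    f (x + s • w) - s * inner ℝ (gradient f x) w - L / 2 * ‖w‖ ^ 2 * s ^ 2 with hh
  have hder : ∀ s, HasDerivAt h (inner ℝ (gradient f (x + s • w)) w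
      - inner ℝ (gradient f x) w - L / 2 * ‖w‖ ^ 2 * (2 * s)) s := by
    intro s
    have h1 : HasDerivAt (fun s : ℝ => x + s • w) w s := by
      simpa using ((hasDerivAt_id s).smul_const w).const_add x
    have h2 := (hf (x + s • w)).hasFDerivAt.comp_hasDerivAt s h1
    rw [← inner_gradient_left] at h2
    have h3 := (hasDerivAt_id s).mul_const (inner ℝ (gradient f x) w)
    have h4 := ((hasDerivAt_id s).pow 2).const_mul (L / 2 * ‖w‖ ^ 2)
    refine ((h2.sub h3).sub h4).congr_deriv ?_
    simp
  have hanti : AntitoneOn h (Set.Icc 0 1) := by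
    refine antitoneOn_of_deriv_nonpos (convex_Icc 0 1)
      (fun s _ => (hder s).continuousAt.continuousWithinAt)
      (fun s _ => (hder s).differentiableAt.differentiableWithinAt) fun s hs => ?_
    rw [interior_Icc] at hs
    rw [(hder s).deriv, ← inner_sub_left]
    have h1 : inner ℝ (gradient f (x + s • w) - gradient f x) w
        ≤ ‖gradient f (x + s • w) - gradient f x‖ * ‖w‖ := real_inner_le_norm _ _
    have h2 := hL.norm_sub_le (x + s • w) x
    rw [add_sub_cancel_left, norm_smul, Real.norm_of_nonneg hs.1.le] at h2
    nlinarith [mul_le_mul_of_nonneg_right h2 (norm_nonneg w)]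
  have := hanti (Set.left_mem_Icc.2 zero_le_one) (Set.right_mem_Icc.2 zero_le_one) zero_le_one
  simp only [hh, one_smul, zero_smul, add_zero, zero_mul, one_mul, sub_zero, one_pow, mul_one,
    ne_eq, OfNat.ofNat_ne_zero, not_false_eq_true, zero_pow, mul_zero] at this
  linarith

/-- A gradient step of length `1 / L` lowers `f` by at least `‖∇f x‖² / (2 L)` and cannot go below
`b`. -/
lemma sq_norm_gradient_le {f : E → ℝ} {L : ℝ≥0} (hL0 : 0 < L) (hf : Differentiable ℝ f)
    (hL : LipschitzWith L (gradient f)) {b : ℝ} (hb : ∀ x, b ≤ f x) (x : E) :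
    ‖gradient f x‖ ^ 2 ≤ 2 * L * (f x - b) := by
  have hL0' : (0 : ℝ) < L := by exact_mod_cast hL0
  have h := (hb _).trans (le_add_inner_gradient_add_sq hf hL x (-(L : ℝ)⁻¹ • gradient f x))
  rw [real_inner_smul_right, real_inner_self_eq_norm_sq, norm_smul, norm_neg, norm_inv,
    Real.norm_of_nonneg hL0'.le] at h
  have h2 : (L : ℝ) / 2 * ((L : ℝ)⁻¹ * ‖gradient f x‖) ^ 2
      = (L : ℝ)⁻¹ * ‖gradient f x‖ ^ 2 / 2 := by field_simp
  rw [h2] at h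
  have h3 : (L : ℝ)⁻¹ * ‖gradient f x‖ ^ 2 ≤ 2 * (f x - b) := by linarith
  rw [inv_mul_le_iff₀ hL0'] at h3
  linarith

end Smooth

/-! ### Deterministic analysis of one pass -/

section Pass

variable {d n : ℕ} {f : Fin n → EuclideanSpace ℝ (Fin d) → ℝ} {lb : Fin n → ℝ} {L : ℝ≥0}

lemma hasGradientAt_objective (hf : SmoothBoundedBelow f lb L) (x : EuclideanSpace ℝ (Fin d)) :
    HasGradientAt (objective f) ((n : ℝ)⁻¹ • ∑ i, gradient (f i) x) x := by
  rw [hasGradientAt_iff_hasFDerivAt]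
  have h1 : HasFDerivAt (fun x => ∑ i, f i x)
      (∑ i, InnerProductSpace.toDual ℝ _ (gradient (f i) x)) x :=
    HasFDerivAt.fun_sum fun i _ => ((hf.differentiable i) x).hasGradientAt.hasFDerivAt
  have h2 := h1.const_mul (1 / (n : ℝ))
  have h3 : InnerProductSpace.toDual ℝ (EuclideanSpace ℝ (Fin d))
      ((n : ℝ)⁻¹ • ∑ i, gradient (f i) x)
      = (1 / (n : ℝ)) • ∑ i, InnerProductSpace.toDual ℝ _ (gradient (f i) x) := by
    ext y
    simp
  rw [h3]
  exact h2

lemma gradient_objective (hf : SmoothBoundedBelow f lb L) (x : EuclideanSpace ℝ (Fin d)) :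
    gradient (objective f) x = (n : ℝ)⁻¹ • ∑ i, gradient (f i) x :=
  (hasGradientAt_objective hf x).gradient

lemma smul_gradient_objective (hn : 0 < n) (hf : SmoothBoundedBelow f lb L)
    (x : EuclideanSpace ℝ (Fin d)) :
    (n : ℝ) • gradient (objective f) x = ∑ i, gradient (f i) x := by
  have : (n : ℝ) ≠ 0 := by positivity
  rw [gradient_objective hf, smul_smul, mul_inv_cancel₀ this, one_smul]

lemma lipschitzWith_gradient_objective (hn : 0 < n) (hf : SmoothBoundedBelow f lb L) :
    LipschitzWith L (gradient (objective f)) := by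
  have hn' : (0 : ℝ) < n := by exact_mod_cast hn
  refine LipschitzWith.of_dist_le_mul fun x y => ?_
  rw [dist_eq_norm, dist_eq_norm, gradient_objective hf, gradient_objective hf, ← smul_sub,
    ← Finset.sum_sub_distrib, norm_smul, norm_inv, Real.norm_natCast, inv_mul_le_iff₀ hn']
  refine (norm_sum_le _ _).trans ?_
  refine (Finset.sum_le_sum fun i _ => (hf.lipschitz i).norm_sub_le x y).trans ?_
  simp

/-- The gap between the objective and the average of the component lower bounds. -/
def gap (f : Fin n → EuclideanSpace ℝ (Fin d) → ℝ) (lb : Fin n → ℝ)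
    (x : EuclideanSpace ℝ (Fin d)) : ℝ :=
  objective f x - (1 / (n : ℝ)) * ∑ i, lb i

lemma card_mul_gap (hn : 0 < n) (x : EuclideanSpace ℝ (Fin d)) :
    n * gap f lb x = ∑ i, (f i x - lb i) := by
  have : (n : ℝ) ≠ 0 := by positivity
  rw [gap, objective, Finset.sum_sub_distrib]
  field_simp

lemma gap_nonneg (hf : SmoothBoundedBelow f lb L) (x : EuclideanSpace ℝ (Fin d)) :
    0 ≤ gap f lb x := by
  rw [gap, objective, ← mul_sub, ← Finset.sum_sub_distrib]
  exact mul_nonneg (by positivity) (Finset.sum_nonneg fun i _ => sub_nonneg.2 (hf.lower_bound i x))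

/-- `B / A` is the mean of `fbar - lb i`, so `fbar` cancels. -/
lemma constF_eq (hn : 0 < n) (hL : 0 < L) (fbar : ℝ) (x : EuclideanSpace ℝ (Fin d)) :
    constF L f lb fbar x = 3 * gap f lb x := by
  have h1 : (n : ℝ) ≠ 0 := by positivity
  have h2 : (L : ℝ) ≠ 0 := by positivity
  rw [constF, constB, constA, gap, Finset.sum_sub_distrib]
  simp only [Finset.sum_const, Finset.card_univ, Fintype.card_fin, nsmul_eq_mul]
  field_simp
  ring

lemma constF_nonneg (hn : 0 < n) (hL : 0 < L) (hf : SmoothBoundedBelow f lb L) (fbar : ℝ)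
    (x : EuclideanSpace ℝ (Fin d)) : 0 ≤ constF L f lb fbar x := by
  rw [constF_eq hn hL]
  linarith [gap_nonneg hf x]

/-- Deviation of the component gradients from the full gradient. -/
def gradDeviation (f : Fin n → EuclideanSpace ℝ (Fin d) → ℝ) (x : EuclideanSpace ℝ (Fin d))
    (i : Fin n) : EuclideanSpace ℝ (Fin d) :=
  gradient (f i) x - gradient (objective f) x

lemma sum_gradDeviation (hn : 0 < n) (hf : SmoothBoundedBelow f lb L)
    (x : EuclideanSpace ℝ (Fin d)) : ∑ i, gradDeviation f x i = 0 := by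
  simp only [gradDeviation, Finset.sum_sub_distrib, Finset.sum_const, Finset.card_univ,
    Fintype.card_fin]
  rw [← smul_gradient_objective hn hf, Nat.cast_smul_eq_nsmul, sub_self]

/-- Variance is at most the second moment, and each `‖∇f_i‖²` is bounded by `2 L (f_i - lb i)`. This
replaces a bounded-variance assumption. -/
lemma sum_sq_norm_gradDeviation_le (hn : 0 < n) (hL : 0 < L) (hf : SmoothBoundedBelow f lb L)
    (x : EuclideanSpace ℝ (Fin d)) :
    ∑ i, ‖gradDeviation f x i‖ ^ 2 ≤ 2 * L * (n * gap f lb x) := by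
  have h1 : ∀ i, ‖gradDeviation f x i‖ ^ 2 = ‖gradient (f i) x‖ ^ 2
      - 2 * inner ℝ (gradient (f i) x) (gradient (objective f) x)
      + ‖gradient (objective f) x‖ ^ 2 := fun i => norm_sub_sq_real _ _
  rw [Finset.sum_congr rfl fun i _ => h1 i, Finset.sum_add_distrib, Finset.sum_sub_distrib,
    ← Finset.mul_sum, ← sum_inner, ← smul_gradient_objective hn hf, real_inner_smul_left,
    real_inner_self_eq_norm_sq, card_mul_gap hn, Finset.mul_sum]
  simp only [Finset.sum_const, Finset.card_univ, Fintype.card_fin, nsmul_eq_mul]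
  have h2 : ∑ i, ‖gradient (f i) x‖ ^ 2 ≤ ∑ i, 2 * L * (f i x - lb i) :=
    Finset.sum_le_sum fun i _ =>
      sq_norm_gradient_le hL (hf.differentiable i) (hf.lipschitz i) (hf.lower_bound i) x
  have h3 : 0 ≤ (n : ℝ) * ‖gradient (objective f) x‖ ^ 2 := by positivity
  linarith

/-- A permutation is well balanced at `x` if all partial sums of the permuted gradient
deviations are controlled by the total variance, with confidence level `l`. -/
def IsBalanced (f : Fin n → EuclideanSpace ℝ (Fin d) → ℝ) (l : ℝ)
    (x : EuclideanSpace ℝ (Fin d)) (σ : Equiv.Perm (Fin n)) : Prop :=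
  ∀ k < n, ‖∑ j ∈ Finset.range k, extendZero (fun i => gradDeviation f x (σ i)) j‖
    ≤ 2 * l * Real.sqrt (∑ i, ‖gradDeviation f x i‖ ^ 2)

lemma extendZero_apply_of_lt {M : Type*} [Zero M] (v : Fin n → M) {j : ℕ} (h : j < n) :
    extendZero v j = v ⟨j, h⟩ := dif_pos h

lemma innerIterate_eq (α : ℝ) (σ : Equiv.Perm (Fin n)) (x : EuclideanSpace ℝ (Fin d)) (k : ℕ) :
    innerIterate f α σ x k = x - α • ∑ j ∈ Finset.range k,
      extendZero (fun i => gradient (f (σ i)) (innerIterate f α σ x j)) j := by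
  induction k with
  | zero => simp [innerIterate]
  | succ k ih =>
    rw [Finset.sum_range_succ, smul_add, ← sub_sub, ← ih]
    by_cases h : k < n <;> simp [innerIterate, extendZero, h]

lemma norm_drift_le (hf : SmoothBoundedBelow f lb L) (α : ℝ) (σ : Equiv.Perm (Fin n))
    (x : EuclideanSpace ℝ (Fin d)) (j : ℕ) :
    ‖extendZero (fun i => gradient (f (σ i)) (innerIterate f α σ x j) - gradient (f (σ i)) x) j‖
      ≤ L * ‖innerIterate f α σ x j - x‖ := by
  unfold extendZero
  split_ifs with h
  · exact (hf.lipschitz _).norm_sub_le _ _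
  · rw [norm_zero]; positivity

/-- Let `D` be the right-hand side. If all earlier displacements are at most `D`, gradient drift
contributes at most `α n L D ≤ D / 4`; the deviations and the mean gradient contribute at most `3 D
/ 4`. Hence the factor `4 / 3`. -/
lemma norm_innerIterate_sub_le (hf : SmoothBoundedBelow f lb L) {α : ℝ} (hα : 0 ≤ α)
    (hαL : 4 * (α * (n * L)) ≤ 1) {l : ℝ} {σ : Equiv.Perm (Fin n)}
    {x : EuclideanSpace ℝ (Fin d)} (hσ : IsBalanced f l x σ) {k : ℕ} (hk : k < n) :
    ‖innerIterate f α σ x k - x‖ ≤ 4 / 3 * (α *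
      (2 * l * Real.sqrt (∑ i, ‖gradDeviation f x i‖ ^ 2)
        + n * ‖gradient (objective f) x‖)) := by
  set R := 2 * l * Real.sqrt (∑ i, ‖gradDeviation f x i‖ ^ 2) with hR
  set g := ‖gradient (objective f) x‖ with hg
  have hR0 : 0 ≤ R := (norm_nonneg _).trans (hσ k hk)
  set D := 4 / 3 * (α * (R + n * g)) with hD
  have hD0 : 0 ≤ D := by positivity
  induction k using Nat.strong_induction_on with
  | _ k ih =>
    have hsplit : ∑ j ∈ Finset.range k,
        extendZero (fun i => gradient (f (σ i)) (innerIterate f α σ x j)) j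
        = ∑ j ∈ Finset.range k, extendZero (fun i =>
            gradient (f (σ i)) (innerIterate f α σ x j) - gradient (f (σ i)) x) j
          + ∑ j ∈ Finset.range k, extendZero (fun i => gradDeviation f x (σ i)) j
          + (k : ℝ) • gradient (objective f) x := by
      have hconst : (k : ℝ) • gradient (objective f) x
          = ∑ _j ∈ Finset.range k, gradient (objective f) x := by
        rw [Finset.sum_const, Finset.card_range, Nat.cast_smul_eq_nsmul]
      rw [hconst, ← Finset.sum_add_distrib, ← Finset.sum_add_distrib]
      refine Finset.sum_congr rfl fun j hj => ?_
      have hjn : j < n := (Finset.mem_range.1 hj).trans hk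
      simp only [extendZero_apply_of_lt _ hjn, gradDeviation]
      abel
    have hdrift : ‖∑ j ∈ Finset.range k, extendZero (fun i =>
        gradient (f (σ i)) (innerIterate f α σ x j) - gradient (f (σ i)) x) j‖ ≤ n * (L * D) := by
      refine (norm_sum_le _ _).trans ((Finset.sum_le_sum fun j hj =>
        (norm_drift_le hf α σ x j).trans (mul_le_mul_of_nonneg_left
          (ih j (Finset.mem_range.1 hj) ((Finset.mem_range.1 hj).trans hk)) L.coe_nonneg)).trans ?_)
      rw [Finset.sum_const, Finset.card_range, nsmul_eq_mul]
      gcongr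
    have hmean : ‖(k : ℝ) • gradient (objective f) x‖ ≤ n * g := by
      rw [norm_smul, Real.norm_natCast]
      gcongr
    have htot := norm_add₃_le.trans (add_le_add_three hdrift (hσ k hk) hmean)
    rw [innerIterate_eq, sub_sub_cancel_left, norm_neg, norm_smul, Real.norm_of_nonneg hα, hsplit]
    calc α * _ ≤ α * (n * (L * D) + R + n * g) := mul_le_mul_of_nonneg_left htot hα
      _ = α * (n * L) * D + 3 / 4 * D := by rw [hD]; ring
      _ ≤ D := by nlinarith

/-- One pass along a balanced permutation decreases the gap up to a small multiplicative error. -/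
theorem gap_innerIterate_le (hn : 0 < n) (hL : 0 < L) (hf : SmoothBoundedBelow f lb L) {α : ℝ}
    (hα : 0 ≤ α) (hαL : 4 * (α * (n * L)) ≤ 1) {l : ℝ} {σ : Equiv.Perm (Fin n)}
    {x : EuclideanSpace ℝ (Fin d)} (hσ : IsBalanced f l x σ) :
    gap f lb (innerIterate f α σ x n) + n * α / 3 * ‖gradient (objective f) x‖ ^ 2
      ≤ (1 + 16 * α ^ 3 * n ^ 2 * L ^ 3 * l ^ 2) * gap f lb x := by
  have hn' : (0 : ℝ) < n := by exact_mod_cast hn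
  have hL' : (0 : ℝ) < L := by exact_mod_cast hL
  set R := 2 * l * Real.sqrt (∑ i, ‖gradDeviation f x i‖ ^ 2) with hR
  set G := gradient (objective f) x with hG
  set g := ‖G‖ with hg
  have hR0 : 0 ≤ R := (norm_nonneg _).trans (hσ 0 hn)
  set D := 4 / 3 * (α * (R + n * g)) with hD
  have hD0 : 0 ≤ D := by positivity
  set e := ∑ j ∈ Finset.range n, extendZero (fun i =>
        gradient (f (σ i)) (innerIterate f α σ x j) - gradient (f (σ i)) x) j with he
  have heD : ‖e‖ ≤ n * (L * D) := by
    refine (norm_sum_le _ _).trans ((Finset.sum_le_sum fun j hj =>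
      (norm_drift_le hf α σ x j).trans (mul_le_mul_of_nonneg_left
        (norm_innerIterate_sub_le hf hα hαL hσ (Finset.mem_range.1 hj)) L.coe_nonneg)).trans ?_)
    rw [Finset.sum_const, Finset.card_range, nsmul_eq_mul]
  have hfull : ∑ j ∈ Finset.range n,
      extendZero (fun i => gradient (f (σ i)) (innerIterate f α σ x j)) j = (n : ℝ) • G + e := by
    have h1 : (n : ℝ) • G = ∑ j ∈ Finset.range n, extendZero (fun i => gradient (f (σ i)) x) j := by
      rw [hG, smul_gradient_objective hn hf, Finset.sum_range,
        ← Equiv.sum_comp σ]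
      exact Finset.sum_congr rfl fun i _ => by simp [extendZero]
    rw [h1, he, ← Finset.sum_add_distrib]
    refine Finset.sum_congr rfl fun j hj => ?_
    simp only [extendZero_apply_of_lt _ (Finset.mem_range.1 hj)]
    abel
  have hend : innerIterate f α σ x n = x + -(α • ((n : ℝ) • G + e)) := by
    rw [innerIterate_eq, hfull, sub_eq_add_neg]
  have hdesc := le_add_inner_gradient_add_sq
    (fun x => (hasGradientAt_objective hf x).differentiableAt)
    (lipschitzWith_gradient_objective hn hf) x (-(α • ((n : ℝ) • G + e)))
  rw [← hend, ← hG, inner_neg_right, real_inner_smul_right, inner_add_right,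
    real_inner_smul_right, real_inner_self_eq_norm_sq, norm_neg, norm_smul,
    Real.norm_of_nonneg hα, mul_pow, norm_add_sq_real, norm_smul, Real.norm_natCast, mul_pow,
    real_inner_smul_left] at hdesc
  set z : ℝ := inner ℝ G e with hz
  set s := ‖e‖ with hs
  have hs0 : 0 ≤ s := norm_nonneg _
  have hgap : gap f lb (innerIterate f α σ x n) - gap f lb x
      = objective f (innerIterate f α σ x n) - objective f x := by unfold gap; ring
  have hsq0 : 0 ≤ (n * g) ^ 2 + 2 * (n * z) + s ^ 2 := by
    have := sq_nonneg ‖(n : ℝ) • G + e‖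
    rw [norm_add_sq_real, norm_smul, Real.norm_natCast, real_inner_smul_left] at this
    linarith
  have hstep : objective f (innerIterate f α σ x n)
      ≤ objective f x - n * α / 2 * g ^ 2 + α / (2 * n) * s ^ 2 := by
    -- Weakening `L α² / 2` to `α / (2 n)` makes the cross term `α z` cancel against the descent
    -- term.
    have h1 : L / 2 * (α ^ 2 * ((n * g) ^ 2 + 2 * (n * z) + s ^ 2))
        ≤ α / (2 * n) * ((n * g) ^ 2 + 2 * (n * z) + s ^ 2) := by
      rw [← mul_assoc]
      refine mul_le_mul_of_nonneg_right ?_ hsq0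
      rw [le_div_iff₀ (by positivity)]
      linarith [mul_le_mul_of_nonneg_left hαL hα]
    have h2 : α / (2 * n) * ((n * g) ^ 2 + 2 * (n * z) + s ^ 2)
        = n * α / 2 * g ^ 2 + α * z + α / (2 * n) * s ^ 2 := by
      field_simp
    rw [mul_pow] at h1 h2
    linarith
  have hs2 : s ^ 2 ≤ (n * L) ^ 2 * (32 / 9 * α ^ 2 * (R ^ 2 + n ^ 2 * g ^ 2)) := by
    calc s ^ 2 ≤ (n * (L * D)) ^ 2 := by gcongr
      _ = (n * L) ^ 2 * (16 / 9 * α ^ 2 * (R + n * g) ^ 2) := by rw [hD]; ring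
      _ ≤ _ := by
        have : (R + n * g) ^ 2 ≤ 2 * (R ^ 2 + n ^ 2 * g ^ 2) := by nlinarith [sq_nonneg (R - n * g)]
        calc (n * L) ^ 2 * (16 / 9 * α ^ 2 * (R + n * g) ^ 2)
            ≤ (n * L) ^ 2 * (16 / 9 * α ^ 2 * (2 * (R ^ 2 + n ^ 2 * g ^ 2))) := by gcongr
          _ = _ := by ring
  have hR2 : R ^ 2 ≤ 4 * l ^ 2 * (2 * L * (n * gap f lb x)) := by
    rw [hR, mul_pow, mul_pow, Real.sq_sqrt (Finset.sum_nonneg fun _ _ => by positivity)]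
    have := sum_sq_norm_gradDeviation_le hn hL hf x
    norm_num
    gcongr
  -- The part `n α g² / 9` fits because `1/2 - 1/9 ≥ 1/3`; the variance part ends with `16/9 * 8 ≤
  -- 16`.
  have herr : α / (2 * n) * s ^ 2
      ≤ 16 / 9 * (α ^ 3 * n * L ^ 2 * R ^ 2) + n * α / 9 * g ^ 2 := by
    have h1 : α / (2 * n) * s ^ 2
        ≤ α / (2 * n) * ((n * L) ^ 2 * (32 / 9 * α ^ 2 * (R ^ 2 + n ^ 2 * g ^ 2))) := by gcongr
    have h2 : α / (2 * n) * ((n * L) ^ 2 * (32 / 9 * α ^ 2 * (R ^ 2 + n ^ 2 * g ^ 2)))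
        = 16 / 9 * (α ^ 3 * n * L ^ 2 * R ^ 2) +
          16 / 9 * ((α * (n * L)) ^ 2 * (n * α * g ^ 2)) := by
      field_simp
      ring
    have h3 : (α * (n * L)) ^ 2 ≤ 1 / 16 := by
      have h0 : 0 ≤ α * (n * L) := by positivity
      have h1 : α * (n * L) ≤ 1 / 4 := by linarith
      calc (α * (n * L)) ^ 2 ≤ (1 / 4) ^ 2 := by gcongr
        _ = 1 / 16 := by norm_num
    have h4 : 0 ≤ n * α * g ^ 2 := by positivity
    have h5 := mul_le_mul_of_nonneg_right h3 h4
    linarith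
  have hR3 : α ^ 3 * n * L ^ 2 * R ^ 2 ≤ 8 * (α ^ 3 * n ^ 2 * L ^ 3 * l ^ 2 * gap f lb x) := by
    calc α ^ 3 * n * L ^ 2 * R ^ 2
        ≤ α ^ 3 * n * L ^ 2 * (4 * l ^ 2 * (2 * L * (n * gap f lb x))) := by gcongr
      _ = _ := by ring
  have hpos : 0 ≤ α ^ 3 * n ^ 2 * L ^ 3 * l ^ 2 * gap f lb x := by
    have := gap_nonneg hf x
    positivity
  have hpos2 : 0 ≤ n * α * g ^ 2 := by positivity
  linarith

end Pass

/-! ### Conditioning on the earlier permutations -/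

section Probability

variable {Ω : Type*} [MeasurableSpace Ω] {μ : Measure Ω} {n : ℕ}
  {π : ℕ → Ω → Equiv.Perm (Fin n)}

/-- If, whatever the first `t` permutations are, at most a fraction `p` of all permutations is bad
for the next pass, then the next permutation is bad with probability at most `p`. -/
theorem IsUniformReshuffling.measureReal_mem_le [IsProbabilityMeasure μ]
    (hπ : IsUniformReshuffling μ π) (t : ℕ)
    (bad : (ℕ → Equiv.Perm (Fin n)) → Set (Equiv.Perm (Fin n)))
    (hbad : ∀ σ σ', (∀ s < t, σ s = σ' s) → bad σ = bad σ') {p : ℝ}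
    (hp : ∀ σ, ((bad σ).ncard : ℝ) ≤ n.factorial * p) :
    μ.real {ω | π t ω ∈ bad fun s => π s ω} ≤ p := by
  classical
  let _ : MeasurableSpace (Equiv.Perm (Fin n)) := ⊤
  have _ : DiscreteMeasurableSpace (Equiv.Perm (Fin n)) := ⟨fun _ => trivial⟩
  have hmeas : ∀ s, Measurable (π s) := fun s => measurable_to_countable' fun σ => hπ.measurable s σ
  let X : Ω → (Finset.range t → Equiv.Perm (Fin n)) := fun ω s => π s ω
  have hX : Measurable X := measurable_pi_lambda _ fun s => hmeas s
  have hind : IndepFun X (π t) μ := by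
    have h := hπ.indep.indepFun_finset (Finset.range t) {t} (by simp) hmeas
    have hproj : Measurable fun y : ({t} : Finset ℕ) → Equiv.Perm (Fin n) =>
        y ⟨t, Finset.mem_singleton_self t⟩ := measurable_pi_apply _
    exact h.comp measurable_id hproj
  -- A finite history is padded by the identity; the padding is harmless since `bad` reads only
  -- times before `t`. The event then splits over the finitely many histories.
  let ext : (Finset.range t → Equiv.Perm (Fin n)) → ℕ → Equiv.Perm (Fin n) :=
    fun h s => if hs : s ∈ Finset.range t then h ⟨s, hs⟩ else 1
  have hext : ∀ ω, bad (fun s => π s ω) = bad (ext (X ω)) := by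
    intro ω
    refine hbad _ _ fun s hs => ?_
    simp [ext, X, hs]
  have hunif : ∀ S : Set (Equiv.Perm (Fin n)), μ.real (π t ⁻¹' S) = S.ncard / n.factorial := by
    intro S
    have h1 : π t ⁻¹' S = π t ⁻¹' (S.toFinset : Set (Equiv.Perm (Fin n))) := by simp
    rw [h1, ← sum_measureReal_preimage_singleton _ fun σ _ => hπ.measurable t σ]
    have h2 : ∀ σ, μ.real (π t ⁻¹' {σ}) = 1 / n.factorial := hπ.uniform t
    rw [Finset.sum_congr rfl fun σ _ => h2 σ, Finset.sum_const, nsmul_eq_mul,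
      ← Set.ncard_eq_toFinset_card', mul_one_div]
  have hcover : {ω | π t ω ∈ bad fun s => π s ω}
      ⊆ ⋃ h ∈ (Finset.univ : Finset (Finset.range t → Equiv.Perm (Fin n))),
        X ⁻¹' {h} ∩ π t ⁻¹' bad (ext h) := by
    intro ω hω
    simp only [Finset.mem_univ, Set.iUnion_true, Set.mem_iUnion]
    refine ⟨X ω, rfl, ?_⟩
    rw [Set.mem_preimage, ← hext]
    exact hω
  have hfact : (0 : ℝ) < n.factorial := by positivity
  have hterm : ∀ h, μ.real (X ⁻¹' {h} ∩ π t ⁻¹' bad (ext h)) ≤ μ.real (X ⁻¹' {h}) * p := by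
    intro h
    rw [measureReal_def, hind.measure_inter_preimage_eq_mul _ _ (MeasurableSet.singleton h)
      (MeasurableSet.of_discrete), ENNReal.toReal_mul]
    refine mul_le_mul_of_nonneg_left ?_ ENNReal.toReal_nonneg
    rw [← measureReal_def, hunif, div_le_iff₀ hfact, mul_comm]
    exact hp _
  have htotal : ∑ h, μ.real (X ⁻¹' {h}) = 1 := by
    rw [sum_measureReal_preimage_singleton _ fun h _ => hX (MeasurableSet.singleton h)]
    simp
  calc μ.real {ω | π t ω ∈ bad fun s => π s ω}
      ≤ μ.real (⋃ h ∈ (Finset.univ : Finset (Finset.range t → Equiv.Perm (Fin n))),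
        X ⁻¹' {h} ∩ π t ⁻¹' bad (ext h)) :=
        measureReal_mono hcover (measure_ne_top _ _)
    _ ≤ ∑ h, μ.real (X ⁻¹' {h} ∩ π t ⁻¹' bad (ext h)) := measureReal_biUnion_finset_le _ _
    _ ≤ ∑ h, μ.real (X ⁻¹' {h}) * p := Finset.sum_le_sum fun h _ => hterm h
    _ = p := by rw [← Finset.sum_mul, htotal, one_mul]

end Probability

/-! ### The whole run and the high-probability rate -/

section Run

variable {d n : ℕ} {f : Fin n → EuclideanSpace ℝ (Fin d) → ℝ} {lb : Fin n → ℝ} {L : ℝ≥0}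

lemma ncard_not_isBalanced_le (hn : 0 < n) (hf : SmoothBoundedBelow f lb L) (l : ℝ)
    (x : EuclideanSpace ℝ (Fin d)) :
    (({σ | ¬ IsBalanced f l x σ} : Set (Equiv.Perm (Fin n))).ncard : ℝ)
      ≤ n.factorial * (n * (8 * Real.exp (-l))) := by
  classical
  set bad : ℕ → Finset (Equiv.Perm (Fin n)) := fun k =>
    Finset.univ.filter fun σ : Equiv.Perm (Fin n) =>
      2 * l * Real.sqrt (∑ i, ‖gradDeviation f x i‖ ^ 2)
        < ‖∑ j ∈ Finset.range k, extendZero (fun i => gradDeviation f x (σ i)) j‖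
  have hsub : ({σ | ¬ IsBalanced f l x σ} : Set (Equiv.Perm (Fin n)))
      ⊆ ((Finset.range n).biUnion bad : Finset _) := by
    intro σ hσ
    simp only [IsBalanced, Set.mem_ofPred_eq, not_forall, not_le] at hσ
    obtain ⟨k, hk, h⟩ := hσ
    exact Finset.mem_coe.2 (Finset.mem_biUnion.2
      ⟨k, Finset.mem_range.2 hk, Finset.mem_filter.2 ⟨Finset.mem_univ _, h⟩⟩)
  have h1 := Set.ncard_le_ncard hsub (Finset.finite_toSet _)
  rw [Set.ncard_coe_finset] at h1
  have h2 : (((Finset.range n).biUnion bad).card : ℝ) ≤ ∑ k ∈ Finset.range n,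
      ((bad k).card : ℝ) := by
    exact_mod_cast Finset.card_biUnion_le
  have h3 : ∑ k ∈ Finset.range n, ((bad k).card : ℝ)
      ≤ ∑ _k ∈ Finset.range n, n.factorial * (8 * Real.exp (-l)) :=
    Finset.sum_le_sum fun k hk => card_perm_norm_partial_sum_gt_le _ (sum_gradDeviation hn hf x)
      (Finset.mem_range.1 hk).le l
  rw [Finset.sum_const, Finset.card_range, nsmul_eq_mul] at h3
  calc _ ≤ (((Finset.range n).biUnion bad).card : ℝ) := by exact_mod_cast h1
    _ ≤ _ := h2.trans (h3.trans (le_of_eq (by ring)))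

lemma iterate_congr (α : ℕ → ℝ) {σ σ' : ℕ → Equiv.Perm (Fin n)} (x₀ : EuclideanSpace ℝ (Fin d))
    {t : ℕ} (h : ∀ s < t, σ s = σ' s) : iterate f α σ x₀ t = iterate f α σ' x₀ t := by
  induction t with
  | zero => rfl
  | succ t ih =>
    rw [iterate, iterate, ih fun s hs => h s (hs.trans t.lt_succ_self), h t t.lt_succ_self]

/-- With high probability every pass of random reshuffling uses a balanced permutation. -/
theorem measureReal_forall_isBalanced {Ω : Type*} [MeasurableSpace Ω] {μ : Measure Ω}
    [IsProbabilityMeasure μ] {π : ℕ → Ω → Equiv.Perm (Fin n)} (hπ : IsUniformReshuffling μ π)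
    (hn : 0 < n) (hf : SmoothBoundedBelow f lb L) (α : ℕ → ℝ) (x₀ : EuclideanSpace ℝ (Fin d))
    (l : ℝ) (T : ℕ) :
    1 - T * (n * (8 * Real.exp (-l))) ≤ μ.real {ω | ∀ t < T,
      IsBalanced f l (iterate f α (fun s => π s ω) x₀ t) (π t ω)} := by
  set good : Set Ω := {ω | ∀ t < T,
      IsBalanced f l (iterate f α (fun s => π s ω) x₀ t) (π t ω)} with hgood
  set bad : ℕ → Set Ω := fun t =>
    {ω | ¬ IsBalanced f l (iterate f α (fun s => π s ω) x₀ t) (π t ω)} with hbad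
  have hbound : ∀ t, μ.real (bad t) ≤ n * (8 * Real.exp (-l)) := fun t =>
    hπ.measureReal_mem_le t (fun σ => {τ | ¬ IsBalanced f l (iterate f α σ x₀ t) τ})
      (fun σ σ' h => by simp only [iterate_congr α x₀ h])
      (fun σ => ncard_not_isBalanced_le hn hf l _)
  -- Subadditivity of a cover, rather than complements, avoids proving these events measurable.
  have hcover : (Set.univ : Set Ω) ⊆ good ∪ ⋃ t ∈ Finset.range T, bad t := by
    intro ω _
    by_cases h : ω ∈ good
    · exact Or.inl h
    · simp only [hgood, Set.mem_ofPred_eq, not_forall] at h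
      obtain ⟨t, ht, hb⟩ := h
      exact Or.inr (Set.mem_biUnion (Finset.mem_coe.2 (Finset.mem_range.2 ht)) hb)
  have h1 : (1 : ℝ) ≤ μ.real good + μ.real (⋃ t ∈ Finset.range T, bad t) := by
    have h := (measureReal_mono (μ := μ) hcover).trans (measureReal_union_le _ _)
    rwa [probReal_univ] at h
  have h2 : μ.real (⋃ t ∈ Finset.range T, bad t) ≤ T * (n * (8 * Real.exp (-l))) := by
    refine (measureReal_biUnion_finset_le _ _).trans
      ((Finset.sum_le_sum fun t _ => hbound t).trans ?_)
    simp
  linarith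

lemma sum_sq_norm_gradient_le (hn : 0 < n) (hL : 0 < L) (hf : SmoothBoundedBelow f lb L) {α : ℝ}
    (hα : 0 ≤ α) (hαL : 4 * (α * (n * L)) ≤ 1) {l : ℝ} {T : ℕ}
    (hαT : 64 * α ^ 3 * n ^ 2 * L ^ 3 * l ^ 2 * T ≤ 1) {σ : ℕ → Equiv.Perm (Fin n)}
    (x₀ : EuclideanSpace ℝ (Fin d))
    (hσ : ∀ t < T, IsBalanced f l (iterate f (fun _ => α) σ x₀ t) (σ t)) :
    n * α / 3 * ∑ t ∈ Finset.range T, ‖gradient (objective f) (iterate f (fun _ => α) σ x₀ t)‖ ^ 2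
      ≤ 3 * gap f lb x₀ := by
  set q : ℝ := 16 * α ^ 3 * n ^ 2 * L ^ 3 * l ^ 2 with hq
  have hq0 : 0 ≤ q := by positivity
  set g : ℕ → ℝ := fun t => ‖gradient (objective f) (iterate f (fun _ => α) σ x₀ t)‖ ^ 2 with hg
  have hg0 : ∀ t, 0 ≤ g t := fun t => by positivity
  -- The accumulated gradient sum stays on the left: it is nonnegative, so multiplying it by `1 + q`
  -- only helps.
  have hind : ∀ t ≤ T, gap f lb (iterate f (fun _ => α) σ x₀ t)
      + n * α / 3 * ∑ s ∈ Finset.range t, g s ≤ (1 + q) ^ t * gap f lb x₀ := by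
    intro t
    induction t with
    | zero => intro _; simp [iterate]
    | succ t ih =>
      intro ht
      have h1 := ih (by omega)
      have h2 := gap_innerIterate_le hn hL hf hα hαL (hσ t (by omega))
      rw [Finset.sum_range_succ, pow_succ]
      have h3 : 0 ≤ n * α / 3 * ∑ s ∈ Finset.range t, g s :=
        mul_nonneg (by positivity) (Finset.sum_nonneg fun s _ => hg0 s)
      have h4 := mul_le_mul_of_nonneg_left h1 (by linarith : 0 ≤ 1 + q)
      have h5 := mul_nonneg hq0 h3
      change gap f lb (innerIterate f α (σ t) (iterate f (fun _ => α) σ x₀ t) n) + _ ≤ _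
      change _ + n * α / 3 * g t ≤ (1 + q) * _ at h2
      linarith
  have hpow : (1 + q) ^ T ≤ 3 := by
    have h1 : (1 + q) ^ T ≤ Real.exp q ^ T := by
      gcongr
      linarith [Real.add_one_le_exp q]
    rw [← Real.exp_nat_mul] at h1
    have h2 : (T : ℝ) * q ≤ 1 := by
      have h3 : 64 * α ^ 3 * n ^ 2 * L ^ 3 * l ^ 2 * T = 4 * (T * q) := by rw [hq]; ring
      linarith
    have h3 := Real.exp_le_exp.2 h2
    linarith [Real.exp_one_lt_d9]
  have h0 := gap_nonneg hf (iterate f (fun _ => α) σ x₀ T)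
  have h1 := hind T le_rfl
  have h2 := mul_le_mul_of_nonneg_right hpow (gap_nonneg hf x₀)
  linarith

lemma one_lt_log_argument {n T : ℕ} {δ : ℝ} (hn : 0 < n) (hT : 0 < T) (hδ : 0 < δ) (hδ1 : δ < 1) :
    1 < 8 * n * T / δ := by
  have h1 : (1 : ℝ) ≤ n := by exact_mod_cast hn
  have h2 : (1 : ℝ) ≤ T := by exact_mod_cast hT
  rw [one_lt_div hδ]
  nlinarith

lemma constC₁_eq (L : ℝ) (n T : ℕ) (δ : ℝ) :
    constC₁ L n T δ = 64 * L ^ 3 * Real.log (8 * n * T / δ) ^ 2 := by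
  rw [constC₁, constA]; ring

/-- Each bound comes from one branch of the minimum; the second is `α³ C₁ n² T ≤ 1` with `C₁ = 64 L³
log²`. -/
lemma stepSize_bounds {L : ℝ} (hL : 0 < L) {n T : ℕ} {δ : ℝ} (hn : 0 < n) (hT : 0 < T)
    (hδ : 0 < δ) (hδ1 : δ < 1) :
    0 < stepSize L n T δ ∧ 4 * (stepSize L n T δ * (n * L)) ≤ 1 ∧
      64 * stepSize L n T δ ^ 3 * n ^ 2 * L ^ 3 * Real.log (8 * n * T / δ) ^ 2 * T ≤ 1 := by
  have hn' : (0 : ℝ) < n := by exact_mod_cast hn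
  have hT' : (0 : ℝ) < T := by exact_mod_cast hT
  have hlog := Real.log_pos (one_lt_log_argument hn hT hδ hδ1)
  set l := Real.log (8 * n * T / δ) with hl
  have hC : 0 < constC₁ L n T δ * (n : ℝ) ^ 2 * T := by rw [constC₁_eq, ← hl]; positivity
  have hpos : 0 < stepSize L n T δ := lt_min (by positivity) (by positivity)
  refine ⟨hpos, ?_, ?_⟩
  · have : stepSize L n T δ ≤ 1 / (4 * n * L) := min_le_left _ _
    rw [le_div_iff₀ (by positivity)] at this
    linarith
  · have h1 : stepSize L n T δ ≤ 1 / (constC₁ L n T δ * (n : ℝ) ^ 2 * T) ^ (1 / 3 : ℝ) :=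
      min_le_right _ _
    have h2 := pow_le_pow_left₀ hpos.le h1 3
    have h3 : ((constC₁ L n T δ * (n : ℝ) ^ 2 * T) ^ (1 / 3 : ℝ)) ^ 3
        = constC₁ L n T δ * (n : ℝ) ^ 2 * T := by
      rw [← Real.rpow_natCast (_ ^ (1 / 3 : ℝ)), ← Real.rpow_mul hC.le]
      norm_num
    rw [div_pow, h3, one_pow, le_div_iff₀ hC, constC₁_eq, ← hl] at h2
    linarith

lemma div_stepSize_le {L : ℝ} (hL : 0 < L) {n T : ℕ} {δ F : ℝ} (hn : 0 < n) (hT : 0 < T)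
    (hδ : 0 < δ) (hδ1 : δ < 1) (hF : 0 ≤ F) :
    3 * F / (n * stepSize L n T δ * T) ≤ max (45 * L * F / T)
      (35 * L ^ (2 / 3 : ℝ) * constA L ^ (1 / 3 : ℝ) * F * Real.log (8 * n * T / δ) ^ (2 / 3 : ℝ)
        / ((n : ℝ) ^ (1 / 3 : ℝ) * (T : ℝ) ^ (2 / 3 : ℝ))) := by
  have hn' : (0 : ℝ) < n := by exact_mod_cast hn
  have hT' : (0 : ℝ) < T := by exact_mod_cast hT
  have hlog := Real.log_pos (one_lt_log_argument hn hT hδ hδ1)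
  have hA : 0 < constA L := by rw [constA]; positivity
  rcases min_choice (1 / (4 * n * L)) (1 / (constC₁ L n T δ * (n : ℝ) ^ 2 * T) ^ (1 / 3 : ℝ))
    with h | h
  · refine le_max_of_le_left ?_
    rw [stepSize, h]
    have h1 : 3 * F / (n * (1 / (4 * n * L)) * T) = 12 * L * F / T := by
      field_simp
      ring
    rw [h1]
    gcongr
    norm_num
  · refine le_max_of_le_right ?_
    rw [stepSize, h, constC₁]
    set l := Real.log (8 * n * T / δ) with hl
    -- Any bound up to `35 / 3` would suffice, since only `3 * 32^(1/3) ≤ 35` is needed.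
    have h32 : (32 : ℝ) ^ (1 / 3 : ℝ) ≤ 4 := by
      have h64 : ((4 : ℝ) ^ (3 : ℝ)) ^ (1 / 3 : ℝ) = 4 := by
        rw [← Real.rpow_mul (by norm_num)]; norm_num
      calc (32 : ℝ) ^ (1 / 3 : ℝ) ≤ ((4 : ℝ) ^ (3 : ℝ)) ^ (1 / 3 : ℝ) := by
            gcongr; norm_num
        _ = 4 := h64
    have hsq : ∀ y : ℝ, 0 < y → (y ^ 2) ^ (1 / 3 : ℝ) = y ^ (2 / 3 : ℝ) := by
      intro y hy
      rw [← Real.rpow_natCast, ← Real.rpow_mul hy.le]; norm_num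
    have hsplit : (32 * L ^ 2 * constA L * l ^ 2 * (n : ℝ) ^ 2 * T) ^ (1 / 3 : ℝ)
        = (32 : ℝ) ^ (1 / 3 : ℝ) * L ^ (2 / 3 : ℝ) * constA L ^ (1 / 3 : ℝ) * l ^ (2 / 3 : ℝ)
          * (n : ℝ) ^ (2 / 3 : ℝ) * (T : ℝ) ^ (1 / 3 : ℝ) := by
      rw [Real.mul_rpow (by positivity) (by positivity), Real.mul_rpow (by positivity)
        (by positivity), Real.mul_rpow (by positivity) (by positivity), Real.mul_rpow
        (by positivity) (by positivity), Real.mul_rpow (by positivity) (by positivity),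
        hsq L hL, hsq l hlog, hsq n hn']
    have hthird : ∀ y : ℝ, 0 < y → y = y ^ (1 / 3 : ℝ) * y ^ (2 / 3 : ℝ) := by
      intro y hy
      rw [← Real.rpow_add hy]; norm_num
    rw [hsplit]
    have hnn := hthird n hn'
    have hTT := hthird T hT'
    set a := (n : ℝ) ^ (1 / 3 : ℝ) with ha
    set b := (n : ℝ) ^ (2 / 3 : ℝ) with hb
    set a' := (T : ℝ) ^ (1 / 3 : ℝ) with ha'
    set b' := (T : ℝ) ^ (2 / 3 : ℝ) with hb'
    set c := (32 : ℝ) ^ (1 / 3 : ℝ) with hc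
    set u := L ^ (2 / 3 : ℝ) * constA L ^ (1 / 3 : ℝ) * l ^ (2 / 3 : ℝ) with hu
    have ha0 : 0 < a := by positivity
    have hb0 : 0 < b := by positivity
    have ha0' : 0 < a' := by positivity
    have hb0' : 0 < b' := by positivity
    have hc0 : 0 < c := by positivity
    have hu0 : 0 < u := by positivity
    have h1 : 3 * F / (n * (1 / (c * L ^ (2 / 3 : ℝ) * constA L ^ (1 / 3 : ℝ) * l ^ (2 / 3 : ℝ)
        * b * a')) * T) = 3 * c * (u * F) / (a * b') := by
      have : c * L ^ (2 / 3 : ℝ) * constA L ^ (1 / 3 : ℝ) * l ^ (2 / 3 : ℝ) = c * u := by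
        rw [hu]; ring
      rw [this, hnn, hTT]
      field_simp
    have h2 : 35 * L ^ (2 / 3 : ℝ) * constA L ^ (1 / 3 : ℝ) * F * l ^ (2 / 3 : ℝ)
        = 35 * (u * F) := by rw [hu]; ring
    rw [h1, h2]
    gcongr
    linarith

/-- The high-probability bound on the average squared gradient norm. -/
theorem measureReal_avgSqGrad_le (hL : 0 < L) {T : ℕ} (hn : 0 < n) (hT : 0 < T) {δ : ℝ}
    (hδ : 0 < δ) (hδ1 : δ < 1) (fbar : ℝ) (x₀ : EuclideanSpace ℝ (Fin d))
    {Ω : Type*} [MeasurableSpace Ω] {μ : Measure Ω} [IsProbabilityMeasure μ]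
    {π : ℕ → Ω → Equiv.Perm (Fin n)} (hf : SmoothBoundedBelow f lb L)
    (hπ : IsUniformReshuffling μ π) :
    1 - δ ≤ μ.real {ω | avgSqGrad L f x₀ T δ (fun t => π t ω) ≤
      max (45 * L * constF L f lb fbar x₀ / T)
        (35 * (L : ℝ) ^ (2 / 3 : ℝ) * constA L ^ (1 / 3 : ℝ) * constF L f lb fbar x₀
          * Real.log (8 * n * T / δ) ^ (2 / 3 : ℝ)
          / ((n : ℝ) ^ (1 / 3 : ℝ) * (T : ℝ) ^ (2 / 3 : ℝ)))} := by
  have hn' : (0 : ℝ) < n := by exact_mod_cast hn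
  have hT' : (0 : ℝ) < T := by exact_mod_cast hT
  have hL' : (0 : ℝ) < L := by exact_mod_cast hL
  obtain ⟨hα, hαL, hαT⟩ := stepSize_bounds hL' hn hT hδ hδ1
  set α := stepSize L n T δ with hαdef
  -- The confidence level `l = log (8 n T / δ)` is the one for which the union bound totals `δ`.
  have hδeq : (T : ℝ) * (n * (8 * Real.exp (-Real.log (8 * n * T / δ)))) = δ := by
    rw [Real.exp_neg, Real.exp_log (by positivity)]
    field_simp
  have hprob := measureReal_forall_isBalanced hπ hn hf (fun _ => α) x₀
    (Real.log (8 * n * T / δ)) T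
  rw [hδeq] at hprob
  refine hprob.trans (measureReal_mono fun ω hω => ?_)
  have hF := constF_nonneg hn hL hf fbar x₀
  refine le_trans ?_ (div_stepSize_le hL' hn hT hδ hδ1 hF)
  have hsum := sum_sq_norm_gradient_le hn hL hf hα.le hαL hαT x₀ hω
  rw [← constF_eq hn hL fbar] at hsum
  rw [avgSqGrad, ← hαdef, le_div_iff₀ (by positivity)]
  have : (1 : ℝ) / T * (∑ t ∈ Finset.range T,
      ‖gradient (objective f) (iterate f (fun _ => α) (fun t => π t ω) x₀ t)‖ ^ 2) * (n * α * T)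
      = 3 * (n * α / 3 * ∑ t ∈ Finset.range T,
      ‖gradient (objective f) (iterate f (fun _ => α) (fun t => π t ω) x₀ t)‖ ^ 2) := by
    field_simp
  rw [this]
  linarith

end Run

/-! ### From the rate to the number of gradient evaluations -/

section Complexity

/-- Removes `y` from inside the logarithm: `log z ≤ 2 √z` and `√(8 y) ≥ 32 c` give `c log (8 y) ≤ y
/ 2`, and `4 c W ≤ y` covers the other half. -/
lemma mul_log_add_le {c y W : ℝ} (hc : 0 < c) (hW : 1 ≤ W)
    (hy : (128 * c ^ 2 + 4 * c) * W ≤ y) : c * (Real.log (8 * y) + 2 * W) ≤ y := by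
  have hy1 : 128 * c ^ 2 ≤ y := by nlinarith [sq_nonneg c]
  have hy2 : 4 * c * W ≤ y := by nlinarith [sq_nonneg c]
  have hy0 : 0 < y := by nlinarith [sq_pos_of_pos hc]
  have h1 : Real.log (8 * y) ≤ 2 * Real.sqrt (8 * y) := by
    have h := Real.log_le_self (Real.sqrt_nonneg (8 * y))
    rw [Real.log_sqrt (by positivity)] at h
    linarith
  have h2 : 32 * c ≤ Real.sqrt (8 * y) := Real.le_sqrt_of_sq_le (by nlinarith)
  have h3 := Real.sq_sqrt (show 0 ≤ 8 * y by positivity)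
  have h4 : c * (2 * Real.sqrt (8 * y)) ≤ y / 2 := by
    nlinarith [Real.sqrt_nonneg (8 * y)]
  nlinarith

/-- The hypothesis is the desired inequality raised to the power `3 / 2`, so that `l` and `T` enter
linearly; `70 L` bounds `35 L^(2/3) (2 L)^(1/3)`. -/
lemma rate_le_sq {L Φ F ε l n T : ℝ} (hL : 0 < L) (hΦ : 0 < Φ) (hF : 0 ≤ F) (hFΦ : F ≤ Φ)
    (hε : 0 < ε) (hl : 0 ≤ l) (hn : 0 < n) (hT : 0 < T)
    (h : (70 * L * Φ) ^ (3 / 2 : ℝ) * l ≤ ε ^ 3 * Real.sqrt n * T) :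
    35 * L ^ (2 / 3 : ℝ) * constA L ^ (1 / 3 : ℝ) * F * l ^ (2 / 3 : ℝ)
      / (n ^ (1 / 3 : ℝ) * T ^ (2 / 3 : ℝ)) ≤ ε ^ 2 := by
  have hA : L ^ (2 / 3 : ℝ) * constA L ^ (1 / 3 : ℝ) ≤ 2 * L := by
    rw [constA]
    calc L ^ (2 / 3 : ℝ) * (2 * L) ^ (1 / 3 : ℝ)
        ≤ (2 * L) ^ (2 / 3 : ℝ) * (2 * L) ^ (1 / 3 : ℝ) := by
          gcongr
          linarith
      _ = 2 * L := by rw [← Real.rpow_add (by positivity)]; norm_num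
  have hpow := Real.rpow_le_rpow (by positivity) h (show (0 : ℝ) ≤ 2 / 3 by norm_num)
  have e1 : ((70 * L * Φ) ^ (3 / 2 : ℝ)) ^ (2 / 3 : ℝ) = 70 * L * Φ := by
    rw [← Real.rpow_mul (by positivity)]; norm_num
  have e2 : (ε ^ 3) ^ (2 / 3 : ℝ) = ε ^ 2 := by
    rw [← Real.rpow_natCast, ← Real.rpow_mul hε.le, ← Real.rpow_natCast]; norm_num
  have e3 : Real.sqrt n ^ (2 / 3 : ℝ) = n ^ (1 / 3 : ℝ) := by
    rw [Real.sqrt_eq_rpow, ← Real.rpow_mul hn.le]; norm_num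
  rw [Real.mul_rpow (by positivity) hl, e1, Real.mul_rpow (by positivity) hT.le,
    Real.mul_rpow (by positivity) (by positivity), e2, e3] at hpow
  rw [div_le_iff₀ (by positivity)]
  calc 35 * L ^ (2 / 3 : ℝ) * constA L ^ (1 / 3 : ℝ) * F * l ^ (2 / 3 : ℝ)
      = 35 * (L ^ (2 / 3 : ℝ) * constA L ^ (1 / 3 : ℝ)) * F * l ^ (2 / 3 : ℝ) := by ring
    _ ≤ 35 * (2 * L) * Φ * l ^ (2 / 3 : ℝ) := by gcongr
    _ = 70 * L * Φ * l ^ (2 / 3 : ℝ) := by ring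
    _ ≤ _ := hpow.trans (le_of_eq (by ring))

/-- The number of passes after which the rate of random reshuffling drops below `ε²`. -/
theorem exists_horizon {L : ℝ} (hL : 0 < L) (Φ : ℝ) : ∃ K : ℝ, 0 < K ∧
    ∀ (n : ℕ) (ε δ : ℝ), 0 < n → 0 < ε → ε ≤ 1 → 0 < δ → δ < 1 →
    ∃ T₀ : ℕ, 0 < T₀ ∧
      (n : ℝ) * T₀ ≤ K * max (Real.sqrt n * ε⁻¹ ^ 3) (n * ε⁻¹ ^ 2)
        * (1 + Real.log (Real.sqrt n * ε⁻¹ ^ 3 / δ)) ∧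
      ∀ (T : ℕ), T₀ ≤ T → ∀ F : ℝ, 0 ≤ F → F ≤ Φ →
        max (45 * L * F / T) (35 * L ^ (2 / 3 : ℝ) * constA L ^ (1 / 3 : ℝ) * F
          * Real.log (8 * n * T / δ) ^ (2 / 3 : ℝ)
          / ((n : ℝ) ^ (1 / 3 : ℝ) * (T : ℝ) ^ (2 / 3 : ℝ))) ≤ ε ^ 2 := by
  -- Keeps the constants positive for an arbitrary real `Φ`.
  set Ψ := max Φ 1 with hΨ
  have hΨ0 : 0 < Ψ := lt_max_of_lt_right one_pos
  set c := (70 * L * Ψ) ^ (3 / 2 : ℝ) with hc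
  have hc0 : 0 < c := by positivity
  set K := 128 * c ^ 2 + 4 * c + 45 * L * Ψ with hK
  have hK0 : 0 < K := by positivity
  -- The extra `1` pays for rounding the horizon up, since `n ≤ N * W`.
  refine ⟨K + 1, by positivity, fun n ε δ hn hε hε1 hδ hδ1 => ?_⟩
  have hn' : (0 : ℝ) < n := by exact_mod_cast hn
  have hn1 : (1 : ℝ) ≤ n := by exact_mod_cast hn
  have he1 : 1 ≤ ε⁻¹ := (one_le_inv₀ hε).2 hε1
  have hs1 : 1 ≤ Real.sqrt n := Real.one_le_sqrt.2 hn1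
  have hsq : Real.sqrt n ^ 2 = n := Real.sq_sqrt hn'.le
  set s := Real.sqrt n with hs
  set e := ε⁻¹ with he
  have hεe : ε * e = 1 := mul_inv_cancel₀ hε.ne'
  have he0 : 0 < e := by positivity
  have hs0 : 0 < s := by positivity
  set N := max (s * e ^ 3) (n * e ^ 2) with hN
  have hnN : n * e ^ 2 ≤ N := le_max_right _ _
  have hsN : s * e ^ 3 ≤ N := le_max_left _ _
  have hN0 : 0 < N := lt_of_lt_of_le (by positivity) hsN
  have harg : 1 ≤ s * e ^ 3 / δ := by
    rw [one_le_div hδ]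
    have : 1 ≤ s * e ^ 3 := one_le_mul_of_one_le_of_one_le hs1 (one_le_pow₀ he1)
    linarith
  set W := 1 + Real.log (s * e ^ 3 / δ) with hW
  have hW1 : 1 ≤ W := by linarith [Real.log_nonneg harg]
  -- Both entries of the maximum, divided by `δ`, are at most `(s e³ / δ)²`, so the single logarithm
  -- in `W` suffices up to a factor `2`.
  have hlogN : Real.log (N / δ) ≤ 2 * W := by
    have h1 : N / δ ≤ (s * e ^ 3 / δ) ^ 2 := by
      have h2 : s * e ^ 3 / δ ≤ (s * e ^ 3 / δ) ^ 2 := by nlinarith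
      have h3 : n * e ^ 2 / δ ≤ (s * e ^ 3 / δ) ^ 2 := by
        rw [div_pow, mul_pow, hsq, ← pow_mul]
        have : e ^ 2 ≤ e ^ (3 * 2) := pow_le_pow_right₀ he1 (by norm_num)
        have : δ ^ 2 ≤ δ := by nlinarith
        gcongr
      rcases max_choice (s * e ^ 3) (n * e ^ 2) with h | h <;> rw [hN, h] <;> assumption
    have h2 := Real.log_le_log (by positivity) h1
    rw [Real.log_pow] at h2
    push_cast at h2
    linarith
  have hX0 : 0 < K * (N / n) * W := by positivity
  refine ⟨⌈K * (N / n) * W⌉₊, Nat.ceil_pos.2 hX0, ?_, ?_⟩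
  · have h1 := (Nat.ceil_lt_add_one hX0.le).le
    have h2 : (n : ℝ) ≤ N * W := by
      have h3 : (n : ℝ) ≤ n * e ^ 2 := le_mul_of_one_le_right hn'.le (one_le_pow₀ he1)
      nlinarith
    calc (n : ℝ) * ⌈K * (N / n) * W⌉₊ ≤ n * (K * (N / n) * W + 1) := by gcongr
      _ = K * N * W + n := by field_simp
      _ ≤ (K + 1) * N * W := by linarith
  · intro T hT F hF hFΦ
    have hFΨ : F ≤ Ψ := hFΦ.trans (le_max_left _ _)
    have hT1 : K * (N / n) * W ≤ T := (Nat.le_ceil _).trans (by exact_mod_cast hT)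
    have hT0 : (0 : ℝ) < T := lt_of_lt_of_le hX0 hT1
    have hTpos : 0 < T := by exact_mod_cast hT0
    refine max_le ?_ ?_
    · rw [div_le_iff₀ hT0]
      have h1 : 45 * L * Ψ * e ^ 2 ≤ K * (N / n) * W := by
        have h2 : e ^ 2 ≤ N / n := by rw [le_div_iff₀ hn']; linarith
        have h3 : 45 * L * Ψ ≤ K := by rw [hK]; nlinarith [sq_nonneg c]
        calc 45 * L * Ψ * e ^ 2 ≤ K * (N / n) := by gcongr
          _ ≤ K * (N / n) * W := le_mul_of_one_le_right (by positivity) hW1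
      calc 45 * L * F ≤ 45 * L * Ψ := by gcongr
        _ = ε ^ 2 * (45 * L * Ψ * e ^ 2) := by
          have : ε ^ 2 * e ^ 2 = 1 := by rw [← mul_pow, hεe, one_pow]
          linear_combination (-(45 * L * Ψ)) * this
        _ ≤ ε ^ 2 * T := mul_le_mul_of_nonneg_left (h1.trans hT1) (by positivity)
    · have hlog := Real.log_pos (one_lt_log_argument hn hTpos hδ hδ1)
      refine rate_le_sq hL hΨ0 hF hFΨ hε hlog.le hn' hT0 ?_
      -- In units of `N / n` the logarithm splits as `log (8 y) + log (N / δ)`, and the lower bound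
      -- on `y` holds for every later `T` as well.
      set y := T / (N / n) with hy
      have hy0 : 0 < y := by positivity
      have hyK : (128 * c ^ 2 + 4 * c) * W ≤ y := by
        rw [hy, le_div_iff₀ (by positivity)]
        have : 0 ≤ 45 * L * Ψ * (N / n) * W := by positivity
        have : K * (N / n) * W
            = (128 * c ^ 2 + 4 * c) * W * (N / n) + 45 * L * Ψ * (N / n) * W := by
          rw [hK]; ring
        linarith
      have hmain := mul_log_add_le hc0 hW1 hyK
      have hfac : 8 * n * T / δ = 8 * y * (N / δ) := by
        rw [hy]; field_simp
      rw [hfac, Real.log_mul (by positivity) (by positivity)]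
      have h1 : c * (Real.log (8 * y) + Real.log (N / δ)) ≤ y :=
        (mul_le_mul_of_nonneg_left (by linarith) hc0.le).trans hmain
      refine h1.trans ?_
      rw [hy, div_le_iff₀ (by positivity)]
      -- The first entry of the maximum is what matters: `ε³ s * (s e³) = s² = n`.
      have h2 : 1 ≤ ε ^ 3 * s * (N / n) := by
        rw [← mul_div_assoc, one_le_div hn']
        calc (n : ℝ) = ε ^ 3 * s * (s * e ^ 3) := by
              have : ε ^ 3 * e ^ 3 = 1 := by rw [← mul_pow, hεe, one_pow]
              linear_combination (-(s ^ 2)) * this - hsq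
          _ ≤ ε ^ 3 * s * N := by gcongr
      calc (T : ℝ) ≤ T * (ε ^ 3 * s * (N / n)) := le_mul_of_one_le_right hT0.le h2
        _ = ε ^ 3 * s * T * (N / n) := by ring

end Complexity

end RandomReshuffling

end

/-! ### The main theorem -/

theorem mainTheorem1 (L : ℝ≥0) (hL : 0 < L) :
    (∀ (d n T : ℕ) (f : Fin n → EuclideanSpace ℝ (Fin d) → ℝ) (lb : Fin n → ℝ) (fbar : ℝ)
        (x₀ : EuclideanSpace ℝ (Fin d)) (δ : ℝ)
        (Ω : Type*) [MeasurableSpace Ω] (μ : Measure Ω) [IsProbabilityMeasure μ]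
        (π : ℕ → Ω → Equiv.Perm (Fin n)),
        0 < n → 0 < T → 0 < δ → δ < 1 →
        RandomReshuffling.SmoothBoundedBelow f lb L →
        (∀ x, fbar ≤ RandomReshuffling.objective f x) →
        RandomReshuffling.IsUniformReshuffling μ π →
        1 - δ ≤ μ.real {ω |
          RandomReshuffling.avgSqGrad L f x₀ T δ (fun t => π t ω) ≤
            max (45 * L * RandomReshuffling.constF L f lb fbar x₀ / T)
              (35 * (L : ℝ) ^ (2 / 3 : ℝ) * RandomReshuffling.constA L ^ (1 / 3 : ℝ)
                  * RandomReshuffling.constF L f lb fbar x₀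
                  * Real.log (8 * n * T / δ) ^ (2 / 3 : ℝ)
                / ((n : ℝ) ^ (1 / 3 : ℝ) * (T : ℝ) ^ (2 / 3 : ℝ)))}) ∧
    (∀ Φ : ℝ, ∃ K : ℝ, 0 < K ∧
      ∀ (n : ℕ) (ε δ : ℝ), 0 < n → 0 < ε → ε ≤ 1 → 0 < δ → δ < 1 →
      ∃ T₀ : ℕ, 0 < T₀ ∧
        (n : ℝ) * T₀ ≤ K * max (Real.sqrt n * ε⁻¹ ^ 3) (n * ε⁻¹ ^ 2)
          * (1 + Real.log (Real.sqrt n * ε⁻¹ ^ 3 / δ)) ∧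
        ∀ (T : ℕ), T₀ ≤ T →
        ∀ (d : ℕ) (f : Fin n → EuclideanSpace ℝ (Fin d) → ℝ) (lb : Fin n → ℝ) (fbar : ℝ)
          (x₀ : EuclideanSpace ℝ (Fin d))
          (Ω : Type*) [MeasurableSpace Ω] (μ : Measure Ω) [IsProbabilityMeasure μ]
          (π : ℕ → Ω → Equiv.Perm (Fin n)),
          RandomReshuffling.SmoothBoundedBelow f lb L →
          (∀ x, fbar ≤ RandomReshuffling.objective f x) →
          RandomReshuffling.constF L f lb fbar x₀ ≤ Φ →
          RandomReshuffling.IsUniformReshuffling μ π →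
          1 - δ ≤ μ.real {ω |
            RandomReshuffling.avgSqGrad L f x₀ T δ (fun t => π t ω) ≤ ε ^ 2}) := by
  refine ⟨?_, fun Φ => ?_⟩
  · intro d n T f lb fbar x₀ δ Ω _ μ _ π hn hT hδ hδ1 hf _ hπ
    exact RandomReshuffling.measureReal_avgSqGrad_le hL hn hT hδ hδ1 fbar x₀ hf hπ
  · obtain ⟨K, hK, h⟩ := RandomReshuffling.exists_horizon (L := L) (by exact_mod_cast hL) Φ
    refine ⟨K, hK, fun n ε δ hn hε hε1 hδ hδ1 => ?_⟩
    obtain ⟨T₀, hT₀, hbound, hrate⟩ := h n ε δ hn hε hε1 hδ hδ1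
    refine ⟨T₀, hT₀, hbound, ?_⟩
    intro T hT d f lb fbar x₀ Ω _ μ _ π hf _ hF hπ
    have hF0 := RandomReshuffling.constF_nonneg hn hL hf fbar x₀
    refine (RandomReshuffling.measureReal_avgSqGrad_le hL hn (hT₀.trans_le hT) hδ hδ1 fbar x₀ hf
      hπ).trans (measureReal_mono fun ω hω => ?_)
    exact le_trans hω (hrate T hT _ hF0 hF)
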